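/- Let $m \le n$ be natural numbers, and let $\mu$ and $\nu$ be Borel probability measures on $\mathbb{R}^m$ and $\mathbb{R}^n$. Write $O(m,n) = \{V \in \mathbb{R}^{m\times n} : VV^{\mathsf T} = I_m\}$, and for $V \in O(m,n)$ and $b \in \mathbb{R}^m$ let $\varphi_{V,b} : \mathbb{R}^n \to \mathbb{R}^m$, $\varphi_{V,b}(x) = Vx+b$. Write $\varphi_{V,b}(\alpha)$ for the pushforward of a measure $\alpha$ under $\varphi_{V,b}$. Let $$\Phi^-(\nu,m) = \{\varphi_{V,b}(\nu) : V \in O(m,n),\ b \in \mathbb{R}^m\},$$ and let $\Phi^+(\mu,n)$ be the set of Borel probability measures $\alpha$ on $\mathbb{R}^n$ such that $\varphi_{V,b}(\alpha) = \mu$ for some $V \in O(m,n)$ and $b \in \mathbb{R}^m$. (i) Let $p \in [1,\infty]$. For Borel probability measures $\rho, \sigma$ on $\mathbb{R}^k$ let $$W_p(\rho,\sigma) = \inf_\gamma \Bigl(\int \|x-y\|_2^p \, d\gamma(x,y)\Bigr)^{1/p},$$ where $\gamma$ runs over the couplings of $\rho$ and $\sigma$, and for $p=\infty$ the integral expression is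 the $\gamma$-essential supremum of $\|x-y\|_2$. If $\mu$ and $\nu$ have finite $p$-th moments (for $p=\infty$: if the norm is essentially bounded under them), then $$\inf_{\beta \in \Phi^-(\nu,m)} W_p(\mu,\beta) = \inf \{ W_p(\alpha,\nu) : \alpha \in \Phi^+(\mu,n),\ \alpha \text{ has finite } p\text{-th moment}\}.$$ (ii) Let $f : [0,\infty) \to (-\infty,\infty]$ be convex, finite on $(0,\infty)$, with $f(1) = 0$. For $\rho$ absolutely continuous with respect to $\sigma$ let $$D_f(\rho\,\Vert\,\sigma) = \int f\Bigl(\frac{d\rho}{d\sigma}\Bigr)\, d\sigma \in (-\infty,\infty].$$ If $\mu$ has a density and $\nu$ has a strictly positive density with respect to Lebesgue measure, then $$\inf_{\beta \in \Phi^-(\nu,m)} D_f(\mu\,\Vert\,\beta) = \inf \{ D_f(\alpha\,\Vert\,\nu) : \alpha \in \Phi^+(\mu,n),\ \alpha \text{ has a density}\}.$$ -/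

import Mathlib

open MeasureTheory
open scoped ENNReal Matrix

noncomputable section

/-- The affine map `φ_{V,b} : ℝⁿ → ℝᵐ`, `x ↦ V x + b`, between Euclidean spaces. -/
def affineProj {m n : ℕ} (V : Matrix (Fin m) (Fin n) ℝ) (b : EuclideanSpace ℝ (Fin m))
    (x : EuclideanSpace ℝ (Fin n)) : EuclideanSpace ℝ (Fin m) :=
  WithLp.toLp 2 (V *ᵥ x.ofLp) + b

/-- The Stiefel manifold of `m × n` real matrices with orthonormal rows. -/
def stiefel (m n : ℕ) : Set (Matrix (Fin m) (Fin n) ℝ) :=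
  {V | V * Vᵀ = 1}

/-- The projections of `ν` onto `ℝᵐ`: all pushforwards of `ν` under the maps `φ_{V,b}`. -/
def projections {n : ℕ} (ν : Measure (EuclideanSpace ℝ (Fin n))) (m : ℕ) :
    Set (Measure (EuclideanSpace ℝ (Fin m))) :=
  {β | ∃ V ∈ stiefel m n, ∃ b : EuclideanSpace ℝ (Fin m), ν.map (affineProj V b) = β}

/-- The embeddings of `μ` into `ℝⁿ`: all probability measures on `ℝⁿ` that some `φ_{V,b}`
pushes forward to `μ`. -/
def embeddings {m : ℕ} (μ : Measure (EuclideanSpace ℝ (Fin m))) (n : ℕ) :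
    Set (Measure (EuclideanSpace ℝ (Fin n))) :=
  {α | IsProbabilityMeasure α ∧
    ∃ V ∈ stiefel m n, ∃ b : EuclideanSpace ℝ (Fin m), α.map (affineProj V b) = μ}

/-- The projection distance `inf {d(μ, β) : β a projection of ν onto ℝᵐ}`. -/
def projDist {L : Type*} [CompleteLattice L] {m n : ℕ}
    (d : Measure (EuclideanSpace ℝ (Fin m)) → Measure (EuclideanSpace ℝ (Fin m)) → L)
    (μ : Measure (EuclideanSpace ℝ (Fin m))) (ν : Measure (EuclideanSpace ℝ (Fin n))) : L :=
  ⨅ β ∈ projections ν m, d μ β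

/-- The embedding distance `inf {d(α, ν) : α an embedding of μ into ℝⁿ, α ∈ C}`, where `C` is
the class of measures on which the distance `d` is considered. -/
def embDist {L : Type*} [CompleteLattice L] {m n : ℕ}
    (d : Measure (EuclideanSpace ℝ (Fin n)) → Measure (EuclideanSpace ℝ (Fin n)) → L)
    (C : Set (Measure (EuclideanSpace ℝ (Fin n))))
    (μ : Measure (EuclideanSpace ℝ (Fin m))) (ν : Measure (EuclideanSpace ℝ (Fin n))) : L :=
  ⨅ α ∈ embeddings μ n ∩ C, d α ν

/-- `μ` has a finite `p`-th moment: `∫ ‖x‖ ^ p dμ < ∞`, and for `p = ∞` the norm is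
essentially bounded. -/
def FiniteMoment {n : ℕ} (p : ℝ≥0∞) (μ : Measure (EuclideanSpace ℝ (Fin n))) : Prop :=
  eLpNorm (fun x => x) p μ < ∞

/-- The couplings of `μ` and `ν`: measures on the product with marginals `μ` and `ν`. -/
def couplings {n : ℕ} (μ ν : Measure (EuclideanSpace ℝ (Fin n))) :
    Set (Measure (EuclideanSpace ℝ (Fin n) × EuclideanSpace ℝ (Fin n))) :=
  {γ | γ.map Prod.fst = μ ∧ γ.map Prod.snd = ν}

/-- The `p`-Wasserstein metric: the infimum over couplings `γ` of `(∫ ‖x - y‖ ^ p dγ) ^ (1/p)`,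
read as the essential supremum of `‖x - y‖` for `p = ∞`. -/
def wasserstein {n : ℕ} (p : ℝ≥0∞) (μ ν : Measure (EuclideanSpace ℝ (Fin n))) : ℝ≥0∞ :=
  ⨅ γ ∈ couplings μ ν, eLpNorm (fun z => z.1 - z.2) p γ

/-- `μ` has a density function with respect to Lebesgue measure. -/
def HasDensity {n : ℕ} (μ : Measure (EuclideanSpace ℝ (Fin n))) : Prop :=
  ∃ g : EuclideanSpace ℝ (Fin n) → ℝ, Measurable g ∧ (∀ x, 0 ≤ g x) ∧
    μ = volume.withDensity fun x => ENNReal.ofReal (g x)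

/-- `μ` has a strictly positive density function with respect to Lebesgue measure. -/
def HasPosDensity {n : ℕ} (μ : Measure (EuclideanSpace ℝ (Fin n))) : Prop :=
  ∃ g : EuclideanSpace ℝ (Fin n) → ℝ, Measurable g ∧ (∀ x, 0 < g x) ∧
    μ = volume.withDensity fun x => ENNReal.ofReal (g x)

/-- The functions that define an `f`-divergence: convex on `[0, ∞)` with `f 1 = 0`, real-valued
except that `f 0 = +∞` is allowed (as for `f t = (t - 1) log t`). Values at negative arguments
play no role, so a convex function `ℝ → ℝ` vanishing at `1` is a special case. Convexity of an
extended-real function means convexity of its epigraph. -/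
structure IsDivergenceFunction (f : ℝ → EReal) : Prop where
  convex_epigraph : Convex ℝ {q : ℝ × ℝ | 0 ≤ q.1 ∧ f q.1 ≤ (q.2 : EReal)}
  ne_bot : ∀ t, 0 ≤ t → f t ≠ ⊥
  ne_top : ∀ t, 0 < t → f t ≠ ⊤
  map_one : f 1 = 0

/-- The `f`-divergence `∫ f (dμ/dν) dν` of `μ` from `ν`, for `μ` absolutely continuous with
respect to `ν`, as the integral of the positive part minus the integral of the negative part.
For probability measures the latter is finite, since a convex function is bounded below
by an affine one. -/
def fDiv {n : ℕ} (f : ℝ → EReal) (μ ν : Measure (EuclideanSpace ℝ (Fin n))) : EReal :=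
  ((∫⁻ x, (f (μ.rnDeriv ν x).toReal).toENNReal ∂ν : ℝ≥0∞) : EReal) -
    ((∫⁻ x, (-f (μ.rnDeriv ν x).toReal).toENNReal ∂ν : ℝ≥0∞) : EReal)

end

/-! Fix `V`, `b` and write φ for the affine map. If φ(α) = μ, then d(φ(α), φ(ν)) ≤ d(α, ν): for
`W_p` because φ is 1-Lipschitz, for `D_f` by data processing. So projection is at most embedding.

Conversely, each β = φ(ν) is matched by an embedding at no greater cost. For `W_p`, glue a coupling
of μ and β to ν, giving pairs (x, z) with x distributed as ν, and move x to x + Vᵀ(z - φ x). The new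
point lies over z, and the move has length ‖z - φ x‖ since Vᵀ is isometric
(`exists_embedding_wasserstein_le`). For `D_f`, reweight ν by (dμ/dβ) ∘ φ: the image is μ and the
density ratio has the same law (`fDiv_withDensity_comp`).

Data processing is Jensen's inequality in subgradient form. Subtracting the supporting line at 1
makes the integrand nonnegative without changing the divergence; truncation makes the linear terms
integrable. -/

namespace IsDivergenceFunction

/-! ### Subgradients of a divergence function -/

variable {f : ℝ → EReal}

lemma coe_toReal (hf : IsDivergenceFunction f) {t : ℝ} (ht : 0 < t) :
    ((f t).toReal : EReal) = f t :=
  EReal.coe_toReal (hf.ne_top t ht) (hf.ne_bot t ht.le)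

lemma le_of_le (hf : IsDivergenceFunction f) {x y u v a b : ℝ} (hx : 0 ≤ x) (hy : 0 ≤ y)
    (hu : f x ≤ (u : EReal)) (hv : f y ≤ (v : EReal)) (ha : 0 ≤ a) (hb : 0 ≤ b)
    (hab : a + b = 1) : f (a * x + b * y) ≤ ((a * u + b * v : ℝ) : EReal) := by
  have h := hf.convex_epigraph (x := (x, u)) ⟨hx, hu⟩ (y := (y, v)) ⟨hy, hv⟩ ha hb hab
  simpa using h.2

lemma convexOn_toReal (hf : IsDivergenceFunction f) :
    ConvexOn ℝ (Set.Ioi 0) fun t => (f t).toReal := by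
  refine ⟨convex_Ioi 0, fun x hx y hy a b ha hb hab => ?_⟩
  have hxy : 0 < a * x + b * y := (convex_Ioi (0 : ℝ)) hx hy ha hb hab
  have h := hf.le_of_le (le_of_lt hx) (le_of_lt hy) (hf.coe_toReal hx).ge (hf.coe_toReal hy).ge
    ha hb hab
  rw [← hf.coe_toReal hxy] at h
  simpa using EReal.coe_le_coe_iff.1 h

/-- The right derivative of the real-valued part of `f`. -/
noncomputable def slopeAt (f : ℝ → EReal) (s : ℝ) : ℝ :=
  derivWithin (fun t => (f t).toReal) (Set.Ioi s) s

lemma monotoneOn_slopeAt (hf : IsDivergenceFunction f) :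
    MonotoneOn (slopeAt f) (Set.Ioi 0) := by
  simpa using! hf.convexOn_toReal.monotoneOn_rightDeriv

lemma subgradient_of_pos (hf : IsDivergenceFunction f) {s t : ℝ} (hs : 0 < s) (ht : 0 < t) :
    (f s).toReal + slopeAt f s * (t - s) ≤ (f t).toReal := by
  have hc := hf.convexOn_toReal
  have hi : s ∈ interior (Set.Ioi (0 : ℝ)) := by simpa using hs
  rcases lt_trichotomy s t with h | rfl | h
  · have := hc.rightDeriv_le_slope_of_mem_interior hi ht h
    rw [slope_def_field, le_div_iff₀ (sub_pos.2 h)] at this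
    simp only [slopeAt]; linarith
  · simp
  · have h1 := hc.slope_le_leftDeriv_of_mem_interior ht hi h
    have := h1.trans (hc.leftDeriv_le_rightDeriv_of_mem_interior hi)
    rw [slope_def_field, div_le_iff₀ (sub_pos.2 h)] at this
    simp only [slopeAt]; linarith

lemma subgradient (hf : IsDivergenceFunction f) {s t : ℝ} (hs : 0 < s) (ht : 0 ≤ t) :
    (((f s).toReal + slopeAt f s * (t - s) : ℝ) : EReal) ≤ f t := by
  rcases ht.eq_or_lt with rfl | ht
  -- Convexity allows a jump at `0`, so continuity is no help. The subgradient inequality at `s / 2`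
  -- and midpoint convexity on `[0, s]` give the bound.
  · by_cases h0 : f 0 = ⊤
    · simp [h0]
    have hc := (EReal.coe_toReal h0 (hf.ne_bot 0 le_rfl))
    have h := hf.le_of_le le_rfl hs.le hc.ge (hf.coe_toReal hs).ge
      (a := 1 / 2) (b := 1 / 2) (by norm_num) (by norm_num) (by norm_num)
    have hp : 0 < 1 / 2 * 0 + 1 / 2 * s := by linarith
    rw [← hf.coe_toReal hp, EReal.coe_le_coe_iff] at h
    have h2 := hf.subgradient_of_pos hs hp
    rw [← hc, EReal.coe_le_coe_iff]
    linarith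
  · rw [← hf.coe_toReal ht, EReal.coe_le_coe_iff]
    exact hf.subgradient_of_pos hs ht

/-- The nonnegative function obtained from `f` by subtracting a supporting line at `1`. -/
noncomputable def normalized (f : ℝ → EReal) (t : ℝ) : ℝ≥0∞ :=
  (f t - ((slopeAt f 1 * (t - 1) : ℝ) : EReal)).toENNReal

lemma normalized_eq_ofReal {t y : ℝ} (h : f t = (y : EReal)) :
    normalized f t = ENNReal.ofReal (y - slopeAt f 1 * (t - 1)) := by
  rw [normalized, h, ← EReal.coe_sub, EReal.toENNReal_of_ne_top (EReal.coe_ne_top _),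
    EReal.toReal_coe]

lemma normalized_eq_top {t : ℝ} (h : f t = ⊤) : normalized f t = ⊤ := by
  rw [normalized, h, EReal.top_sub_coe, EReal.toENNReal_top]

lemma supporting_line_le (hf : IsDivergenceFunction f) {t y : ℝ} (ht : 0 ≤ t)
    (h : f t = (y : EReal)) : slopeAt f 1 * (t - 1) ≤ y := by
  have := hf.subgradient one_pos ht
  rw [h, EReal.coe_le_coe_iff, hf.map_one] at this
  simpa using this

/-- This is `f = normalized f + line` with negative parts moved across to stay in `[0, ∞]`. When `t`
is a density of mean `1`, the affine terms on the two sides have equal integrals and cancel. -/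
lemma toENNReal_add_eq (hf : IsDivergenceFunction f) {t : ℝ} (ht : 0 ≤ t) :
    (f t).toENNReal + (ENNReal.ofReal (-slopeAt f 1) * ENNReal.ofReal t
        + ENNReal.ofReal (slopeAt f 1)) =
      (-f t).toENNReal + normalized f t + (ENNReal.ofReal (slopeAt f 1) * ENNReal.ofReal t
        + ENNReal.ofReal (-slopeAt f 1)) := by
  by_cases h : f t = ⊤
  · simp [normalized_eq_top h, h]
  obtain ⟨y, hy⟩ : ∃ y : ℝ, f t = (y : EReal) := ⟨_, (EReal.coe_toReal h (hf.ne_bot t ht)).symm⟩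
  have hle := hf.supporting_line_le ht hy
  rw [normalized_eq_ofReal hy, hy, ← EReal.coe_neg,
    EReal.toENNReal_of_ne_top (EReal.coe_ne_top _), EReal.toENNReal_of_ne_top (EReal.coe_ne_top _),
    EReal.toReal_coe, EReal.toReal_coe]
  rw [← ENNReal.toReal_eq_toReal_iff' (by finiteness) (by finiteness)]
  repeat rw [ENNReal.toReal_add (by finiteness) (by finiteness)]
  simp only [ENNReal.toReal_mul, ENNReal.toReal_ofReal', max_eq_left ht,
    max_eq_left (sub_nonneg.2 hle)]
  have e : ∀ z : ℝ, max z 0 = z + max (-z) 0 := fun z => by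
    rcases le_total z 0 with hz | hz <;> simp [hz]
  rw [e y, e (slopeAt f 1)]
  ring

lemma neg_toENNReal_le (hf : IsDivergenceFunction f) {t : ℝ} (ht : 0 ≤ t) :
    (-f t).toENNReal ≤ ENNReal.ofReal (-slopeAt f 1) * ENNReal.ofReal t
        + ENNReal.ofReal (slopeAt f 1) := by
  by_cases h : f t = ⊤
  · simp [h]
  obtain ⟨y, hy⟩ : ∃ y : ℝ, f t = (y : EReal) := ⟨_, (EReal.coe_toReal h (hf.ne_bot t ht)).symm⟩
  have hle := hf.supporting_line_le ht hy
  rw [hy, ← EReal.coe_neg, EReal.toENNReal_of_ne_top (EReal.coe_ne_top _), EReal.toReal_coe,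
    ← ENNReal.ofReal_mul' ht]
  refine (ENNReal.ofReal_le_ofReal ?_).trans ENNReal.ofReal_add_le
  linarith

/-- The subgradient inequality at `s`, the slope being split into positive and negative parts to
avoid subtraction. -/
lemma normalized_add_le (hf : IsDivergenceFunction f) {s t : ℝ} (hs : 0 < s) (ht : 0 ≤ t) :
    normalized f s + (ENNReal.ofReal (slopeAt f s - slopeAt f 1) * ENNReal.ofReal t
        + ENNReal.ofReal (-(slopeAt f s - slopeAt f 1)) * ENNReal.ofReal s) ≤
      normalized f t + (ENNReal.ofReal (-(slopeAt f s - slopeAt f 1)) * ENNReal.ofReal t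
        + ENNReal.ofReal (slopeAt f s - slopeAt f 1) * ENNReal.ofReal s) := by
  by_cases h : f t = ⊤
  · simp [normalized_eq_top h]
  obtain ⟨y, hy⟩ : ∃ y : ℝ, f t = (y : EReal) := ⟨_, (EReal.coe_toReal h (hf.ne_bot t ht)).symm⟩
  have hsub := hf.subgradient hs ht
  rw [hy, EReal.coe_le_coe_iff] at hsub
  have hle := hf.supporting_line_le ht hy
  have hle' := hf.supporting_line_le hs.le (hf.coe_toReal hs).symm
  rw [normalized_eq_ofReal hy, normalized_eq_ofReal (hf.coe_toReal hs).symm]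
  rw [← ENNReal.toReal_le_toReal (by finiteness) (by finiteness)]
  repeat rw [ENNReal.toReal_add (by finiteness) (by finiteness)]
  simp only [ENNReal.toReal_mul, ENNReal.toReal_ofReal', max_eq_left ht, max_eq_left hs.le,
    max_eq_left (sub_nonneg.2 hle), max_eq_left (sub_nonneg.2 hle')]
  have e : ∀ z : ℝ, max z 0 = z + max (-z) 0 := fun z => by
    rcases le_total z 0 with hz | hz <;> simp [hz]
  rw [e (slopeAt f s - slopeAt f 1)]
  nlinarith

end IsDivergenceFunction

/-! ### Measurability -/

/-- `toReal` never takes negative values, so only the behaviour on `(0, ∞)` and the single value at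
`0` matter; `F` itself need not be measurable. -/
lemma measurable_comp_toReal_of_eqOn_pos {β : Type*} [MeasurableSpace β] {F Φ : ℝ → β}
    (hΦ : Measurable Φ) (h : ∀ t, 0 < t → F t = Φ t) :
    Measurable fun x : ℝ≥0∞ => F x.toReal := by
  have e : (fun x : ℝ≥0∞ => F x.toReal) =
      fun x : ℝ≥0∞ => if 0 < x.toReal then Φ x.toReal else F 0 := by
    funext x
    split_ifs with hx
    · exact h _ hx
    · rw [le_antisymm (not_lt.1 hx) ENNReal.toReal_nonneg]
  rw [e]
  exact Measurable.ite (measurableSet_lt measurable_const ENNReal.measurable_toReal)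
    (hΦ.comp ENNReal.measurable_toReal) measurable_const

namespace IsDivergenceFunction

variable {f : ℝ → EReal}

lemma exists_measurable_toReal (hf : IsDivergenceFunction f) :
    ∃ Φ : ℝ → ℝ, Measurable Φ ∧ ∀ t, 0 < t → f t = (Φ t : EReal) := by
  classical
  refine ⟨(Set.Ioi 0).piecewise (fun t => (f t).toReal) 0, ?_, fun t ht => ?_⟩
  · exact (hf.convexOn_toReal.continuousOn isOpen_Ioi).measurable_piecewise
      continuous_const.continuousOn measurableSet_Ioi
  · rw [Set.piecewise_eq_of_mem _ _ _ (Set.mem_Ioi.2 ht), hf.coe_toReal ht]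

lemma measurable_comp_toReal (hf : IsDivergenceFunction f) :
    Measurable fun x : ℝ≥0∞ => f x.toReal := by
  obtain ⟨Φ, hΦ, h⟩ := hf.exists_measurable_toReal
  exact measurable_comp_toReal_of_eqOn_pos hΦ.coe_real_ereal h

lemma measurable_normalized_comp_toReal (hf : IsDivergenceFunction f) :
    Measurable fun x : ℝ≥0∞ => normalized f x.toReal := by
  obtain ⟨Φ, hΦ, h⟩ := hf.exists_measurable_toReal
  exact measurable_comp_toReal_of_eqOn_pos
    (Φ := fun t => ENNReal.ofReal (Φ t - slopeAt f 1 * (t - 1))) (by fun_prop)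
    fun t ht => normalized_eq_ofReal (h t ht)

lemma measurable_slopeAt_comp_toReal (hf : IsDivergenceFunction f) :
    Measurable fun x : ℝ≥0∞ => slopeAt f x.toReal := by
  have hm : Measurable fun s : Set.Ioi (0 : ℝ) => slopeAt f s :=
    Monotone.measurable fun s t hst => hf.monotoneOn_slopeAt s.2 t.2 hst
  refine measurable_comp_toReal_of_eqOn_pos (Φ := Set.indicator (Set.Ioi 0) (slopeAt f)) ?_
    fun t ht => (Set.indicator_of_mem (Set.mem_Ioi.2 ht) _).symm
  refine measurable_of_restrict_of_restrict_compl (measurableSet_Ioi (a := (0 : ℝ))) ?_ ?_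
  · convert hm using 1
    ext s
    exact Set.indicator_of_mem s.2 _
  · convert measurable_const (a := (0 : ℝ)) using 1
    ext s
    exact Set.indicator_of_notMem s.2 _

end IsDivergenceFunction

/-! ### Data processing inequality -/

section DataProcessing

variable {X Y : Type*} [MeasurableSpace X] [MeasurableSpace Y]

/-- Used for `φ` and again for the identity on `Y`, it shows that both linear terms in Jensen's
inequality have the same integral. -/
lemma setLIntegral_comp_mul_rnDeriv {α ν : Measure X} [SigmaFinite α] [SigmaFinite ν]
    (hα : α ≪ ν) {φ : X → Y} (hφ : Measurable φ) {u : Y → ℝ≥0∞} (hu : Measurable u)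
    {S : Set Y} (hS : MeasurableSet S) :
    ∫⁻ x in φ ⁻¹' S, u (φ x) * α.rnDeriv ν x ∂ν = ∫⁻ y in S, u y ∂α.map φ := by
  rw [setLIntegral_map hS hu hφ]
  conv_rhs => rw [← Measure.withDensity_rnDeriv_eq α ν hα]
  rw [setLIntegral_withDensity_eq_setLIntegral_mul _ (Measure.measurable_rnDeriv α ν)
    (g := fun x => u (φ x)) (hu.comp hφ) (hφ hS)]
  simp [mul_comm]

namespace IsDivergenceFunction

variable {f : ℝ → EReal}

/-- Jensen's inequality for the pushforward, localized to a set on which the linear terms of the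
subgradient inequality are integrable. -/
lemma setLIntegral_normalized_rnDeriv_map_le (hf : IsDivergenceFunction f) {α ν : Measure X}
    [IsFiniteMeasure α] [IsFiniteMeasure ν] (hα : α ≪ ν) {φ : X → Y} (hφ : Measurable φ)
    {S : Set Y} (hS : MeasurableSet S) {C : ℝ}
    (hC : ∀ y ∈ S, 0 < ((α.map φ).rnDeriv (ν.map φ) y).toReal →
      |slopeAt f ((α.map φ).rnDeriv (ν.map φ) y).toReal - slopeAt f 1| ≤ C) :
    ∫⁻ y in S, normalized f ((α.map φ).rnDeriv (ν.map φ) y).toReal ∂ν.map φ ≤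
      ∫⁻ x, normalized f (α.rnDeriv ν x).toReal ∂ν := by
  have hαφ : α.map φ ≪ ν.map φ := hα.map hφ
  set r : Y → ℝ≥0∞ := (α.map φ).rnDeriv (ν.map φ) with hr
  set h : X → ℝ≥0∞ := α.rnDeriv ν with hh
  have hrm : Measurable r := Measure.measurable_rnDeriv _ _
  have hhm : Measurable h := Measure.measurable_rnDeriv _ _
  let P : Set Y := {y | 0 < (r y).toReal}
  have hP : MeasurableSet P := measurableSet_lt measurable_const hrm.ennreal_toReal
  -- The subgradient slope of the normalized function; it is set to `0` where the density vanishes,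
  -- since no slope is available there.
  let d : Y → ℝ := P.indicator fun y => slopeAt f (r y).toReal - slopeAt f 1
  have hd : Measurable d :=
    ((hf.measurable_slopeAt_comp_toReal.comp hrm).sub_const _).indicator hP
  have hdC : ∀ y ∈ S, |d y| ≤ max C 0 := fun y hy => by
    by_cases hyP : y ∈ P
    · simpa [d, hyP] using Or.inl (hC y hy hyP)
    · simp [d, hyP]
  have hdm : Measurable fun y => ENNReal.ofReal (d y) := hd.ennreal_ofReal
  have hdm' : Measurable fun y => ENNReal.ofReal (-d y) := hd.neg.ennreal_ofReal
  have hgm : Measurable fun y => normalized f (r y).toReal :=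
    hf.measurable_normalized_comp_toReal.comp hrm
  have hfin : ∀ e : Y → ℝ, (∀ y, e y ≤ |d y|) →
      ∫⁻ y in S, ENNReal.ofReal (e y) ∂α.map φ ≠ ∞ := fun e he => by
    refine ne_top_of_le_ne_top ?_ (setLIntegral_mono' hS fun y hy =>
      ENNReal.ofReal_le_ofReal ((he y).trans (hdC y hy)))
    rw [lintegral_const]
    finiteness
  have hswap : ∀ u : Y → ℝ≥0∞, Measurable u →
      ∫⁻ x in φ ⁻¹' S, u (φ x) * r (φ x) ∂ν = ∫⁻ y in S, u y ∂α.map φ := fun u hu => by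
    have := setLIntegral_comp_mul_rnDeriv hαφ measurable_id hu hS
    rw [Measure.map_id] at this
    rw [← this]
    exact (setLIntegral_map hS (hu.mul hrm) hφ).symm
  -- The set `r ∘ φ = 0` has α-measure zero, so both sides of the pointwise inequality agree there.
  have hzero : ∀ᵐ x ∂ν, r (φ x) = 0 → h x = 0 := by
    have hZ : MeasurableSet {y | r y = 0} := hrm (measurableSet_singleton 0)
    have h0 := setLIntegral_comp_mul_rnDeriv hα hφ (measurable_const (a := (1 : ℝ≥0∞))) hZ
    have h1 : (α.map φ) {y | r y = 0} = 0 := by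
      rw [← Measure.setLIntegral_rnDeriv hαφ]
      exact (setLIntegral_congr_fun hZ fun y hy => hy).trans (by simp)
    simp only [one_mul, lintegral_const, Measure.restrict_apply, MeasurableSet.univ,
      Set.univ_inter, h1, mul_zero] at h0
    rw [lintegral_eq_zero_iff hhm] at h0
    exact (ae_restrict_iff' (hφ hZ)).1 h0
  have hpt : ∀ᵐ x ∂ν, normalized f (r (φ x)).toReal +
      (ENNReal.ofReal (d (φ x)) * h x + ENNReal.ofReal (-d (φ x)) * r (φ x)) ≤
      normalized f (h x).toReal +
      (ENNReal.ofReal (-d (φ x)) * h x + ENNReal.ofReal (d (φ x)) * r (φ x)) := by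
    filter_upwards [hzero, Measure.rnDeriv_ne_top α ν,
      ae_of_ae_map hφ.aemeasurable (Measure.rnDeriv_ne_top (α.map φ) (ν.map φ))] with x h0 h1 h2
    by_cases hx : φ x ∈ P
    · have := hf.normalized_add_le hx (ENNReal.toReal_nonneg (a := h x))
      rw [ENNReal.ofReal_toReal h1, ENNReal.ofReal_toReal h2] at this
      simpa only [d, Set.indicator_of_mem hx] using this
    · have h3 : r (φ x) = 0 := by
        by_contra h3
        exact hx (ENNReal.toReal_pos h3 h2)
      simp [h3, h0 h3]
  have key := lintegral_mono_ae (ae_restrict_of_ae (s := φ ⁻¹' S) hpt)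
  have hgφ : Measurable fun x => normalized f (r (φ x)).toReal := hgm.comp hφ
  have hgh : Measurable fun x => normalized f (h x).toReal :=
    hf.measurable_normalized_comp_toReal.comp hhm
  have hdφ : Measurable fun x => ENNReal.ofReal (d (φ x)) * h x := (hdm.comp hφ).mul hhm
  have hdφ' : Measurable fun x => ENNReal.ofReal (-d (φ x)) * h x := (hdm'.comp hφ).mul hhm
  rw [lintegral_add_left hgφ, lintegral_add_left hdφ, lintegral_add_left hgh,
    lintegral_add_left hdφ', hswap _ hdm, hswap _ hdm',
    setLIntegral_comp_mul_rnDeriv hα hφ hdm hS, setLIntegral_comp_mul_rnDeriv hα hφ hdm' hS,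
    add_comm (∫⁻ y in S, ENNReal.ofReal (-d y) ∂α.map φ)] at key
  rw [setLIntegral_map hS hgm hφ]
  refine (ENNReal.le_of_add_le_add_right ?_ key).trans (setLIntegral_le_lintegral _ _)
  -- The cancelled terms are finite because `d` is bounded on `S`.
  exact ENNReal.add_ne_top.2 ⟨hfin _ fun y => le_abs_self _, hfin _ fun y => neg_le_abs _⟩

lemma lintegral_normalized_rnDeriv_map_le (hf : IsDivergenceFunction f) {α ν : Measure X}
    [IsFiniteMeasure α] [IsFiniteMeasure ν] (hα : α ≪ ν) {φ : X → Y} (hφ : Measurable φ) :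
    ∫⁻ y, normalized f ((α.map φ).rnDeriv (ν.map φ) y).toReal ∂ν.map φ ≤
      ∫⁻ x, normalized f (α.rnDeriv ν x).toReal ∂ν := by
  set r : Y → ℝ≥0∞ := (α.map φ).rnDeriv (ν.map φ) with hr
  have hrm : Measurable fun y => (r y).toReal := (Measure.measurable_rnDeriv _ _).ennreal_toReal
  -- On the interval the monotone slope lies between its endpoint values, and at `0` no slope is
  -- used. These sets increase to `Y`, so monotone convergence removes the truncation.
  let S : ℕ → Set Y := fun k =>
    {y | (r y).toReal = 0} ∪ {y | (r y).toReal ∈ Set.Icc (1 / ((k : ℝ) + 1)) (k + 1)}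
  have hS : ∀ k, MeasurableSet (S k) := fun k =>
    (hrm (measurableSet_singleton 0)).union (hrm measurableSet_Icc)
  have hmono : Monotone S := fun k l hkl => by
    have : (k : ℝ) ≤ l := by exact_mod_cast hkl
    refine Set.union_subset_union_right _ fun y hy => ⟨le_trans ?_ hy.1, hy.2.trans ?_⟩
    · gcongr
    · gcongr
  have huniv : ⋃ k, S k = Set.univ := by
    refine Set.eq_univ_of_forall fun y => Set.mem_iUnion.2 ?_
    rcases (ENNReal.toReal_nonneg (a := r y)).eq_or_lt with h | h
    · exact ⟨0, Or.inl h.symm⟩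
    · obtain ⟨k, hk⟩ := exists_nat_gt (max (r y).toReal (1 / (r y).toReal))
      rw [max_lt_iff] at hk
      refine ⟨k, Or.inr ⟨?_, by linarith [hk.1]⟩⟩
      rw [div_le_iff₀ (by positivity)]
      have := (div_lt_iff₀ h).1 hk.2
      nlinarith
  rw [← setLIntegral_univ, ← huniv, setLIntegral_iUnion_of_directed _ hmono.directed_le]
  refine iSup_le fun k => ?_
  refine hf.setLIntegral_normalized_rnDeriv_map_le hα hφ (hS k)
    (C := max (slopeAt f (k + 1) - slopeAt f 1) (slopeAt f 1 - slopeAt f (1 / (k + 1))))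
    fun y hy hpos => ?_
  rcases hy with hy | hy
  · exact absurd hy hpos.ne'
  · have hk : (0 : ℝ) < 1 / (k + 1) := by positivity
    have h1 := hf.monotoneOn_slopeAt hk hpos hy.1
    have h2 := hf.monotoneOn_slopeAt hpos (Set.mem_Ioi.2 (by positivity)) hy.2
    rw [abs_le]
    constructor
    · have := le_max_right (slopeAt f (k + 1) - slopeAt f 1) (slopeAt f 1 - slopeAt f (1 / (k + 1)))
      linarith
    · exact le_max_of_le_left (by linarith)

end IsDivergenceFunction

end DataProcessing

/-! ### The divergence as the integral of a nonnegative function -/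

namespace IsDivergenceFunction

variable {f : ℝ → EReal} {n : ℕ}

lemma fDiv_eq_lintegral_normalized (hf : IsDivergenceFunction f)
    {α ν : Measure (EuclideanSpace ℝ (Fin n))} [IsProbabilityMeasure α] [IsProbabilityMeasure ν]
    (hα : α ≪ ν) : fDiv f α ν = ((∫⁻ x, normalized f (α.rnDeriv ν x).toReal ∂ν : ℝ≥0∞) : EReal) := by
  have hrm : Measurable (α.rnDeriv ν) := Measure.measurable_rnDeriv _ _
  have hfm : Measurable fun x => (f (α.rnDeriv ν x).toReal).toENNReal :=
    (hf.measurable_comp_toReal.comp hrm).ereal_toENNReal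
  have hfm' : Measurable fun x => (-f (α.rnDeriv ν x).toReal).toENNReal :=
    (hf.measurable_comp_toReal.comp hrm).neg.ereal_toENNReal
  have hgm : Measurable fun x => normalized f (α.rnDeriv ν x).toReal :=
    hf.measurable_normalized_comp_toReal.comp hrm
  have hsum : Measurable fun x =>
      (-f (α.rnDeriv ν x).toReal).toENNReal + normalized f (α.rnDeriv ν x).toReal := hfm'.add hgm
  have := Measure.haveLebesgueDecomposition_of_sigmaFinite α ν
  have hlin : ∀ a b : ℝ≥0∞, ∫⁻ x, (a * ENNReal.ofReal (α.rnDeriv ν x).toReal + b) ∂ν = a + b := by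
    intro a b
    have : ∫⁻ x, ENNReal.ofReal (α.rnDeriv ν x).toReal ∂ν = 1 := by
      rw [lintegral_congr_ae (Measure.rnDeriv_ne_top α ν |>.mono fun x hx =>
        ENNReal.ofReal_toReal hx), Measure.lintegral_rnDeriv hα, measure_univ]
    rw [lintegral_add_right _ measurable_const, lintegral_const_mul _
      hrm.ennreal_toReal.ennreal_ofReal, this]
    simp
  have key := lintegral_congr (μ := ν) fun x =>
    hf.toENNReal_add_eq (ENNReal.toReal_nonneg (a := α.rnDeriv ν x))
  rw [lintegral_add_left hfm, hlin, lintegral_add_left hsum, lintegral_add_left hfm',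
    hlin, add_comm (ENNReal.ofReal (-_)), ENNReal.add_left_inj (by finiteness)] at key
  -- Finiteness permits cancelling the negative part in `EReal`.
  have hneg : ∫⁻ x, (-f (α.rnDeriv ν x).toReal).toENNReal ∂ν ≠ ∞ := by
    refine ne_top_of_le_ne_top ?_ (lintegral_mono fun x =>
      hf.neg_toENNReal_le (ENNReal.toReal_nonneg (a := α.rnDeriv ν x)))
    rw [hlin]
    finiteness
  rw [fDiv, key]
  lift ∫⁻ x, (-f (α.rnDeriv ν x).toReal).toENNReal ∂ν to NNReal using hneg with z
  simp only [EReal.coe_ennreal_add]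
  rw [add_comm]
  exact EReal.add_sub_cancel_right (b := (z : ℝ))

end IsDivergenceFunction

/-! ### Geometry of the affine projections -/

section AffineProj

variable {m n : ℕ} {V : Matrix (Fin m) (Fin n) ℝ} {b : EuclideanSpace ℝ (Fin m)}

lemma affineProj_eq_toLpLin (V : Matrix (Fin m) (Fin n) ℝ) (b : EuclideanSpace ℝ (Fin m))
    (x : EuclideanSpace ℝ (Fin n)) : affineProj V b x = Matrix.toLpLin 2 2 V x + b := by
  simp [affineProj, Matrix.toLpLin_apply]

lemma measurable_affineProj (V : Matrix (Fin m) (Fin n) ℝ) (b : EuclideanSpace ℝ (Fin m)) :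
    Measurable (affineProj V b) := by
  simp_rw [funext (affineProj_eq_toLpLin V b)]
  exact (LinearMap.continuous_of_finiteDimensional _).measurable.add_const b

lemma toLpLin_toLpLin_transpose (hV : V ∈ stiefel m n) (y : EuclideanSpace ℝ (Fin m)) :
    Matrix.toLpLin 2 2 V (Matrix.toLpLin 2 2 Vᵀ y) = y := by
  have hV' : V * Vᵀ = 1 := hV
  simp [Matrix.toLpLin_apply, Matrix.mulVec_mulVec, hV']

lemma inner_toLpLin_left (V : Matrix (Fin m) (Fin n) ℝ) (x : EuclideanSpace ℝ (Fin n))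
    (y : EuclideanSpace ℝ (Fin m)) :
    inner ℝ (Matrix.toLpLin 2 2 V x) y = inner ℝ x (Matrix.toLpLin 2 2 Vᵀ y) := by
  simp only [EuclideanSpace.inner_eq_star_dotProduct, Matrix.toLpLin_apply, star_trivial]
  rw [Matrix.dotProduct_mulVec, Matrix.mulVec_transpose]

lemma norm_toLpLin_transpose (hV : V ∈ stiefel m n) (y : EuclideanSpace ℝ (Fin m)) :
    ‖Matrix.toLpLin 2 2 Vᵀ y‖ = ‖y‖ := by
  rw [← sq_eq_sq₀ (norm_nonneg _) (norm_nonneg _), ← real_inner_self_eq_norm_sq,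
    ← inner_toLpLin_left, toLpLin_toLpLin_transpose hV, real_inner_self_eq_norm_sq]

lemma norm_toLpLin_le (hV : V ∈ stiefel m n) (x : EuclideanSpace ℝ (Fin n)) :
    ‖Matrix.toLpLin 2 2 V x‖ ≤ ‖x‖ := by
  -- Cauchy–Schwarz: ‖Vx‖² = ⟨x, VᵀVx⟩ ≤ ‖x‖ ‖Vx‖.
  have h := real_inner_le_norm x (Matrix.toLpLin 2 2 Vᵀ (Matrix.toLpLin 2 2 V x))
  rw [← inner_toLpLin_left, real_inner_self_eq_norm_sq, norm_toLpLin_transpose hV] at h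
  nlinarith [norm_nonneg x, norm_nonneg (Matrix.toLpLin 2 2 V x)]

lemma norm_affineProj_sub_le (hV : V ∈ stiefel m n) (x y : EuclideanSpace ℝ (Fin n)) :
    ‖affineProj V b x - affineProj V b y‖ ≤ ‖x - y‖ := by
  rw [affineProj_eq_toLpLin, affineProj_eq_toLpLin, add_sub_add_right_eq_sub, ← map_sub]
  exact norm_toLpLin_le hV _

/-- A surjective linear map pulls back only null sets to null sets, and translation by `b` preserves
Lebesgue measure. -/
lemma volume_absolutelyContinuous_map_affineProj (hV : V ∈ stiefel m n)
    {ν : Measure (EuclideanSpace ℝ (Fin n))} (hν : volume ≪ ν) :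
    volume ≪ ν.map (affineProj V b) := by
  refine Measure.AbsolutelyContinuous.mk fun s hs h => ?_
  rw [Measure.map_apply (measurable_affineProj V b) hs] at h
  have hsurj : Function.Surjective (Matrix.toLpLin 2 2 V) := fun y =>
    ⟨_, toLpLin_toLpLin_transpose hV y⟩
  have hs' : MeasurableSet ((fun y => y + b) ⁻¹' s) := (measurable_add_const b) hs
  have h2 := (ae_comp_linearMap_mem_iff (Matrix.toLpLin 2 2 V) volume volume hsurj hs'.compl).1 (by
    filter_upwards [measure_eq_zero_iff_ae_notMem.1 (hν h)] with x hx
    simpa [affineProj_eq_toLpLin] using hx)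
  rw [← measure_preimage_add_right volume b s]
  exact measure_eq_zero_iff_ae_notMem.2 h2

end AffineProj

/-! ### Densities and absolute continuity -/

section Density

variable {n : ℕ} {μ : Measure (EuclideanSpace ℝ (Fin n))}

lemma HasDensity.absolutelyContinuous (h : HasDensity μ) : μ ≪ volume := by
  obtain ⟨g, -, -, rfl⟩ := h
  exact withDensity_absolutelyContinuous _ _

lemma HasPosDensity.absolutelyContinuous (h : HasPosDensity μ) : μ ≪ volume := by
  obtain ⟨g, -, -, rfl⟩ := h
  exact withDensity_absolutelyContinuous _ _

lemma HasPosDensity.volume_absolutelyContinuous (h : HasPosDensity μ) : volume ≪ μ := by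
  obtain ⟨g, hg, hpos, rfl⟩ := h
  exact withDensity_absolutelyContinuous' hg.ennreal_ofReal.aemeasurable
    (.of_forall fun x => (ENNReal.ofReal_pos.2 (hpos x)).ne')

lemma hasDensity_of_absolutelyContinuous [IsFiniteMeasure μ] (h : μ ≪ volume) : HasDensity μ := by
  refine ⟨fun x => (μ.rnDeriv volume x).toReal, (Measure.measurable_rnDeriv _ _).ennreal_toReal,
    fun x => ENNReal.toReal_nonneg, ?_⟩
  conv_lhs => rw [← Measure.withDensity_rnDeriv_eq μ volume h]
  refine withDensity_congr_ae ?_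
  filter_upwards [Measure.rnDeriv_ne_top μ volume] with x hx
  exact (ENNReal.ofReal_toReal hx).symm

end Density

/-! ### Lifting measures along a map -/

section Lift

variable {X Y : Type*} [MeasurableSpace X] [MeasurableSpace Y]

lemma map_withDensity_comp (ν : Measure X) {φ : X → Y} (hφ : Measurable φ) {r : Y → ℝ≥0∞}
    (hr : Measurable r) :
    (ν.withDensity fun x => r (φ x)).map φ = (ν.map φ).withDensity r := by
  ext s hs
  rw [Measure.map_apply hφ hs, withDensity_apply _ (hφ hs), withDensity_apply _ hs,
    setLIntegral_map hs hr hφ]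

/-- Gluing along a map: a coupling of `μ` and `ν.map φ` lifts to a joint law of `μ` and `ν`. -/
lemma exists_lift_coupling {Z : Type*} [MeasurableSpace Z] [StandardBorelSpace Z] [Nonempty Z]
    {ν : Measure X} [IsFiniteMeasure ν] {φ : X → Y} (hφ : Measurable φ) {γ : Measure (Z × Y)}
    (hγ : γ.map Prod.snd = ν.map φ) :
    ∃ π : Measure (X × Z), π.map Prod.fst = ν ∧ π.map (fun q => (q.2, φ q.1)) = γ := by
  have hfin : IsFiniteMeasure γ := by
    have : IsFiniteMeasure (γ.map Prod.snd) := hγ ▸ inferInstance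
    exact Measure.isFiniteMeasure_of_map measurable_snd.aemeasurable
  let ρ : Measure (Y × Z) := γ.map Prod.swap
  have hρ : ρ.fst = ν.map φ := by
    rw [← hγ, Measure.fst, Measure.map_map measurable_fst measurable_swap]
    rfl
  have hd : (ν.map φ).compProd ρ.condKernel = ρ := by
    rw [← hρ]; exact ρ.disintegrate ρ.condKernel
  -- Given `x`, draw `z` from the conditional law of γ over the point `φ x`.
  refine ⟨ν.compProd (ρ.condKernel.comap φ hφ), Measure.fst_compProd _ _, ?_⟩
  have hswap : γ = ρ.map Prod.swap := by
    rw [Measure.map_map measurable_swap measurable_swap]; simp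
  have hm : Measurable fun q : X × Z => (q.2, φ q.1) := by fun_prop
  refine Eq.trans ?_ ((congrArg (Measure.map Prod.swap) hd).trans hswap.symm)
  ext s hs
  rw [Measure.map_apply hm hs, Measure.map_apply measurable_swap hs,
    Measure.compProd_apply (hm hs), Measure.compProd_apply (measurable_swap hs),
    lintegral_map (ProbabilityTheory.Kernel.measurable_kernel_prodMk_left (measurable_swap hs)) hφ]
  rfl

end Lift

/-! ### Wasserstein distances -/

section Wasserstein

variable {m n : ℕ} {V : Matrix (Fin m) (Fin n) ℝ} {b : EuclideanSpace ℝ (Fin m)}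

lemma wasserstein_map_affineProj_le (hV : V ∈ stiefel m n) (p : ℝ≥0∞)
    (α ν : Measure (EuclideanSpace ℝ (Fin n))) :
    wasserstein p (α.map (affineProj V b)) (ν.map (affineProj V b)) ≤ wasserstein p α ν := by
  have hφ := measurable_affineProj V b
  refine le_iInf₂ fun γ hγ => ?_
  have hφφ := hφ.prodMap hφ
  have hmem : γ.map (Prod.map (affineProj V b) (affineProj V b)) ∈
      couplings (α.map (affineProj V b)) (ν.map (affineProj V b)) := by
    refine ⟨?_, ?_⟩
    · rw [← hγ.1, Measure.map_map measurable_fst hφφ, Measure.map_map hφ measurable_fst]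
      rfl
    · rw [← hγ.2, Measure.map_map measurable_snd hφφ, Measure.map_map hφ measurable_snd]
      rfl
  refine (iInf₂_le _ hmem).trans ?_
  rw [eLpNorm_map_measure (by fun_prop) hφφ.aemeasurable]
  exact eLpNorm_mono fun z => norm_affineProj_sub_le hV _ _

lemma exists_embedding_wasserstein_le (hV : V ∈ stiefel m n) {p : ℝ≥0∞} (hp : 1 ≤ p)
    {μ : Measure (EuclideanSpace ℝ (Fin m))} {ν : Measure (EuclideanSpace ℝ (Fin n))}
    [IsProbabilityMeasure ν] (hν : FiniteMoment p ν)
    {γ : Measure (EuclideanSpace ℝ (Fin m) × EuclideanSpace ℝ (Fin m))}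
    (hγ : γ ∈ couplings μ (ν.map (affineProj V b)))
    (hfin : eLpNorm (fun z => z.1 - z.2) p γ ≠ ∞) :
    ∃ α ∈ embeddings μ n ∩ {α | FiniteMoment p α},
      wasserstein p α ν ≤ eLpNorm (fun z => z.1 - z.2) p γ := by
  have hφ := measurable_affineProj V b
  obtain ⟨π, hπ1, hπ2⟩ := exists_lift_coupling hφ hγ.2
  let U : EuclideanSpace ℝ (Fin m) → EuclideanSpace ℝ (Fin n) := Matrix.toLpLin 2 2 Vᵀ
  have hU : Measurable U := (LinearMap.continuous_of_finiteDimensional _).measurable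
  let T : EuclideanSpace ℝ (Fin n) × EuclideanSpace ℝ (Fin m) → EuclideanSpace ℝ (Fin n) :=
    fun q => q.1 + U (q.2 - affineProj V b q.1)
  have hT : Measurable T := by
    exact measurable_fst.add (hU.comp (measurable_snd.sub (hφ.comp measurable_fst)))
  have hφT : ∀ q, affineProj V b (T q) = q.2 := fun q => by
    simp only [T, U, affineProj_eq_toLpLin, map_add, toLpLin_toLpLin_transpose hV]
    abel
  have hm : Measurable fun q : EuclideanSpace ℝ (Fin n) × EuclideanSpace ℝ (Fin m) =>
      (q.2, affineProj V b q.1) := by fun_prop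
  have hprob : IsProbabilityMeasure π := by
    have : IsProbabilityMeasure (π.map Prod.fst) := hπ1 ▸ inferInstance
    exact Measure.isProbabilityMeasure_of_map Prod.fst
  have hcost : eLpNorm (fun q => T q - q.1) p π = eLpNorm (fun z => z.1 - z.2) p γ := by
    rw [← hπ2, eLpNorm_map_measure (by fun_prop) hm.aemeasurable]
    refine eLpNorm_congr_norm_ae (.of_forall fun q => ?_)
    simp only [T, U, add_sub_cancel_left, norm_toLpLin_transpose hV, Function.comp_apply]
  refine ⟨π.map T, ⟨⟨Measure.isProbabilityMeasure_map hT.aemeasurable, V, hV, b, ?_⟩, ?_⟩, ?_⟩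
  · rw [Measure.map_map hφ hT, ← hγ.1, ← hπ2, Measure.map_map measurable_fst hm]
    exact congrArg (fun g => π.map g) (funext hφT)
  · have hfst : eLpNorm (fun q => q.1) p π < ∞ := by
      have h := hν
      rw [FiniteMoment, ← hπ1, eLpNorm_map_measure (by fun_prop) (by fun_prop)] at h
      exact h
    -- Minkowski's inequality: the moment of `T` is at most the transport cost plus the moment of ν.
    have hsum := eLpNorm_add_le (μ := π) (f := fun q => T q - q.1) (g := fun q => q.1)
      (hT.sub measurable_fst).aestronglyMeasurable measurable_fst.aestronglyMeasurable hp
    have he : ((fun q => T q - q.1) + fun q => q.1) = T := by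
      funext q; simp
    rw [he, hcost] at hsum
    change eLpNorm (fun x => x) p (π.map T) < ∞
    rw [eLpNorm_map_measure (by fun_prop) hT.aemeasurable]
    exact hsum.trans_lt (ENNReal.add_lt_top.2 ⟨hfin.lt_top, hfst⟩)
  · have hTf : Measurable fun q => (T q, q.1) := hT.prodMk measurable_fst
    have hmem : π.map (fun q => (T q, q.1)) ∈ couplings (π.map T) ν := by
      refine ⟨?_, ?_⟩
      · rw [Measure.map_map measurable_fst hTf]
        rfl
      · rw [Measure.map_map measurable_snd hTf]
        exact hπ1
    refine (iInf₂_le _ hmem).trans ?_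
    rw [eLpNorm_map_measure (by fun_prop) hTf.aemeasurable]
    exact hcost.le

theorem projDist_wasserstein_eq_embDist {p : ℝ≥0∞} (hp : 1 ≤ p)
    (μ : Measure (EuclideanSpace ℝ (Fin m))) (ν : Measure (EuclideanSpace ℝ (Fin n)))
    [IsProbabilityMeasure ν] (hν : FiniteMoment p ν) :
    projDist (wasserstein p) μ ν = embDist (wasserstein p) {α | FiniteMoment p α} μ ν := by
  refine le_antisymm (le_iInf₂ ?_) (le_iInf₂ ?_)
  · rintro α ⟨⟨-, V, hV, b, rfl⟩, -⟩
    exact (iInf₂_le _ ⟨V, hV, b, rfl⟩).trans (wasserstein_map_affineProj_le hV p α ν)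
  · rintro β ⟨V, hV, b, rfl⟩
    refine le_iInf₂ fun γ hγ => ?_
    -- Only a coupling of finite cost is lifted, since the lift must have a finite moment.
    by_cases hfin : eLpNorm (fun z => z.1 - z.2) p γ = ∞
    · rw [hfin]; exact le_top
    · obtain ⟨α, hα, hle⟩ := exists_embedding_wasserstein_le hV hp hν hγ hfin
      exact (iInf₂_le α hα).trans hle

end Wasserstein

/-! ### Divergences -/

section Divergence

variable {m n : ℕ} {V : Matrix (Fin m) (Fin n) ℝ} {b : EuclideanSpace ℝ (Fin m)} {f : ℝ → EReal}

lemma IsDivergenceFunction.fDiv_map_le (hf : IsDivergenceFunction f)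
    {α ν : Measure (EuclideanSpace ℝ (Fin n))} [IsProbabilityMeasure α] [IsProbabilityMeasure ν]
    (hα : α ≪ ν) {φ : EuclideanSpace ℝ (Fin n) → EuclideanSpace ℝ (Fin m)} (hφ : Measurable φ) :
    fDiv f (α.map φ) (ν.map φ) ≤ fDiv f α ν := by
  have := Measure.isProbabilityMeasure_map (μ := α) hφ.aemeasurable
  have := Measure.isProbabilityMeasure_map (μ := ν) hφ.aemeasurable
  rw [hf.fDiv_eq_lintegral_normalized hα, hf.fDiv_eq_lintegral_normalized (hα.map hφ)]
  exact EReal.coe_ennreal_le_coe_ennreal_iff.2 (hf.lintegral_normalized_rnDeriv_map_le hα hφ)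

lemma IsDivergenceFunction.fDiv_withDensity_comp (hf : IsDivergenceFunction f)
    {μ : Measure (EuclideanSpace ℝ (Fin m))} {ν : Measure (EuclideanSpace ℝ (Fin n))}
    [SigmaFinite ν] {φ : EuclideanSpace ℝ (Fin n) → EuclideanSpace ℝ (Fin m)}
    (hφ : Measurable φ) :
    fDiv f (ν.withDensity fun x => μ.rnDeriv (ν.map φ) (φ x)) ν = fDiv f μ (ν.map φ) := by
  have hr : Measurable (μ.rnDeriv (ν.map φ)) := Measure.measurable_rnDeriv _ _
  have hfm := hf.measurable_comp_toReal.comp hr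
  have hd : (ν.withDensity fun x => μ.rnDeriv (ν.map φ) (φ x)).rnDeriv ν =ᵐ[ν]
      fun x => μ.rnDeriv (ν.map φ) (φ x) := Measure.rnDeriv_withDensity ν (hr.comp hφ)
  have hpos : Measurable fun y => (f (μ.rnDeriv (ν.map φ) y).toReal).toENNReal :=
    hfm.ereal_toENNReal
  have hneg : Measurable fun y => (-f (μ.rnDeriv (ν.map φ) y).toReal).toENNReal :=
    hfm.neg.ereal_toENNReal
  rw [fDiv, fDiv, lintegral_map hpos hφ, lintegral_map hneg hφ]
  congr 2
  · exact lintegral_congr_ae (hd.mono fun x hx => by simp only [hx])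
  · exact lintegral_congr_ae (hd.mono fun x hx => by simp only [hx])

theorem IsDivergenceFunction.projDist_fDiv_eq_embDist (hf : IsDivergenceFunction f)
    {μ : Measure (EuclideanSpace ℝ (Fin m))} [IsProbabilityMeasure μ]
    {ν : Measure (EuclideanSpace ℝ (Fin n))} [IsProbabilityMeasure ν]
    (hμ : HasDensity μ) (hν : HasPosDensity ν) :
    projDist (fDiv f) μ ν = embDist (fDiv f) {α | HasDensity α} μ ν := by
  refine le_antisymm (le_iInf₂ ?_) (le_iInf₂ ?_)
  · rintro α ⟨⟨hα, V, hV, b, rfl⟩, hαd⟩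
    exact (iInf₂_le _ ⟨V, hV, b, rfl⟩).trans (hf.fDiv_map_le
      (HasDensity.absolutelyContinuous hαd |>.trans hν.volume_absolutelyContinuous)
      (measurable_affineProj V b))
  · rintro β ⟨V, hV, b, rfl⟩
    have hφ := measurable_affineProj V b
    have hr : Measurable (μ.rnDeriv (ν.map (affineProj V b))) := Measure.measurable_rnDeriv _ _
    -- Lebesgue measure lies in between: μ has a density, and ν charges every set of positive
    -- volume.
    have hμν : μ ≪ ν.map (affineProj V b) := hμ.absolutelyContinuous.trans
      (volume_absolutelyContinuous_map_affineProj hV hν.volume_absolutelyContinuous)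
    have hmap := map_withDensity_comp ν hφ hr
    have := Measure.isProbabilityMeasure_map (μ := ν) hφ.aemeasurable
    have := Measure.haveLebesgueDecomposition_of_sigmaFinite μ (ν.map (affineProj V b))
    rw [Measure.withDensity_rnDeriv_eq _ _ hμν] at hmap
    rw [← hf.fDiv_withDensity_comp hφ]
    set α := ν.withDensity fun x => μ.rnDeriv (ν.map (affineProj V b)) (affineProj V b x)
    have hprob : IsProbabilityMeasure α := by
      have : IsProbabilityMeasure (α.map (affineProj V b)) := hmap ▸ inferInstance
      exact Measure.isProbabilityMeasure_of_map (affineProj V b)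
    exact iInf₂_le α ⟨⟨hprob, V, hV, b, hmap⟩, hasDensity_of_absolutelyContinuous
      ((withDensity_absolutelyContinuous _ _).trans hν.absolutelyContinuous)⟩

end Divergence

theorem theorem1p2 (m n : ℕ) (hmn : m ≤ n)
    (μ : Measure (EuclideanSpace ℝ (Fin m))) [IsProbabilityMeasure μ]
    (ν : Measure (EuclideanSpace ℝ (Fin n))) [IsProbabilityMeasure ν] :
    (∀ p : ℝ≥0∞, 1 ≤ p → FiniteMoment p μ → FiniteMoment p ν →
      projDist (wasserstein p) μ ν = embDist (wasserstein p) {α | FiniteMoment p α} μ ν) ∧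
    (∀ f : ℝ → EReal, IsDivergenceFunction f → HasDensity μ → HasPosDensity ν →
      projDist (fDiv f) μ ν = embDist (fDiv f) {α | HasDensity α} μ ν) :=
  ⟨fun _ hp _ hν => projDist_wasserstein_eq_embDist hp μ ν hν,
    fun _ hf hμ hν => hf.projDist_fDiv_eq_embDist hμ hν⟩
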